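/- A digraph is a finite directed graph without loops and without parallel edges; anti-parallel edges (both $(u,v)$ and $(v,u)$) are allowed. An induced copy of a digraph $D$ in a digraph $G$ is an induced subdigraph of $G$ isomorphic to $D$, and $G$ is induced $D$-free if it contains no induced copy of $D$. Write $v(D)$ for the number of vertices of $D$. We say that induced $D$-freeness is easily testable (equivalently, that the induced $D$-removal lemma has polynomial bounds) if there are a function $\delta:(0,\infty)\to(0,\infty)$ and a real polynomial $P$ with $1/\delta(\varepsilon)\le P(1/\varepsilon)$ for all $0<\varepsilon<1$, such that for every $\varepsilon>0$ and every $n$, every $n$-vertex digraph $G$ with at most $\delta(\varepsilon)\,n^{v(D)}$ induced copies of $D$ can be made induced $D$-free by changing at most $\varepsilon n^2$ entries in its adjacency matrix (the result again being a digraph). Theorem. Let $D$ be a digraph with $v(D)\ge 2$. Then induced $D$-freeness is easily testable if and only if $v(D)=2$. -/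

import Mathlib

namespace Digraph

/-- No vertex has an edge to itself. Together with `Digraph` (at most one edge from `u` to `v` for
each ordered pair, edges in both directions allowed), this is the usual notion of a digraph with
anti-parallel edges but without parallel edges and loops. -/
def Loopless {V : Type*} (G : Digraph V) : Prop :=
  ∀ v, ¬ G.Adj v v

/-- The number of induced copies of `D` in `G`, that is, the number of vertex sets `S` of `G` such
that the subdigraph of `G` induced on `S` is isomorphic to `D`. An element of `D.Adj ↪r G.Adj` is
an injective map `f` with `G.Adj (f u) (f v) ↔ D.Adj u v` for all `u` and `v`. -/
noncomputable def inducedCopies {V W : Type*} (D : Digraph V) (G : Digraph W) : ℕ :=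
  {S : Set W | ∃ f : D.Adj ↪r G.Adj, Set.range f = S}.ncard

/-- `G` contains no induced copy of `D`. -/
def InducedFree {V W : Type*} (D : Digraph V) (G : Digraph W) : Prop :=
  IsEmpty (D.Adj ↪r G.Adj)

/-- The number of entries in which the adjacency matrices of `G` and `G'` differ. -/
noncomputable def editDistance {W : Type*} (G G' : Digraph W) : ℕ :=
  {p : W × W | ¬ (G.Adj p.1 p.2 ↔ G'.Adj p.1 p.2)}.ncard

/-- The induced `D`-removal lemma holds with the function `δ`: for every `ε > 0` we have
`δ ε > 0`, and every `n`-vertex digraph with at most `δ ε * n ^ v(D)` induced copies of `D` can be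
made induced `D`-free by changing at most `ε * n ^ 2` entries of its adjacency matrix. -/
def InducedRemovalWith {V : Type*} [Fintype V] (D : Digraph V) (δ : ℝ → ℝ) : Prop :=
  ∀ ε : ℝ, 0 < ε → 0 < δ ε ∧
    ∀ (n : ℕ) (G : Digraph (Fin n)), G.Loopless →
      (D.inducedCopies G : ℝ) ≤ δ ε * (n : ℝ) ^ Fintype.card V →
      ∃ G' : Digraph (Fin n), G'.Loopless ∧ D.InducedFree G' ∧
        (G.editDistance G' : ℝ) ≤ ε * (n : ℝ) ^ 2

/-- Induced `D`-freeness is easily testable: the induced `D`-removal lemma has polynomial bounds,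
i.e. it holds with a function `δ` for which `1 / δ` is bounded by a polynomial in `1 / ε`. -/
def InducedEasilyTestable {V : Type*} [Fintype V] (D : Digraph V) : Prop :=
  ∃ δ : ℝ → ℝ, D.InducedRemovalWith δ ∧
    ∃ P : Polynomial ℝ, ∀ ε : ℝ, 0 < ε → ε < 1 → 1 / δ ε ≤ P.eval (1 / ε)

end Digraph

/-! If `D` has two vertices, recolouring every pair that spans a copy costs two entries per copy, so
a linear `δ` suffices. For three or more vertices, a Behrend-type construction defeats every
polynomial. Take one part per vertex of `D`, each a box in `ℤ^r`, and call a pair between parts `i`,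
`j` special if its difference is `(l j - l i) * d` with `d` on a fixed sphere. Special pairs look
like `D`. A starting point and a vector `d` give a planted copy, and any two of its vertices
determine both, so planted copies share no pair and each needs its own edit. By strict convexity of
the sphere, a special triangle uses a single `d`, so two of its vertices and the part of the third
determine the third. Hence if every copy of `D` contains a special triangle, there are only `O(n ^
(h - 1))` copies, where `h = v(D)`. It remains to choose the non-special pairs so that every copy,
planted or not, contains a special triangle (`hasRigidHost_of_three_le_card`). A pair of `D` has one
of three types: no edge, both edges, one edge. If some triple avoids a type, giving all non-special
pairs that type makes its three pairs special. Otherwise every triple is rainbow, which forces at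
most four vertices, and these two cases get defaults of their own. -/

namespace Digraph

/-! ### Rigid hosts -/

section Host

variable {V A : Type*}

/-- Parts indexed by the vertices of `D`: a pair of vertices in different parts looks like `D` if it
is in `S` and like `R` otherwise, and each part is a copy of `T`. -/
def host (D : Digraph V) (R : V → V → Prop) (T : A → A → Prop) (S : V × A → V × A → Prop) :
    Digraph (V × A) where
  Adj p q := (p.1 = q.1 ∧ T p.2 q.2) ∨
    (p.1 ≠ q.1 ∧ ((S p q ∧ D.Adj p.1 q.1) ∨ (¬ S p q ∧ R p.1 q.1)))

theorem host_adj {D : Digraph V} {R : V → V → Prop} {T : A → A → Prop} {S : V × A → V × A → Prop}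
    {p q : V × A} : (D.host R T S).Adj p q ↔ (p.1 = q.1 ∧ T p.2 q.2) ∨
      (p.1 ≠ q.1 ∧ ((S p q ∧ D.Adj p.1 q.1) ∨ (¬ S p q ∧ R p.1 q.1))) := Iff.rfl

/-- There are default relations between and inside the parts such that every induced copy of `D`
in the resulting host contains a triangle of special pairs. -/
def HasRigidHost (D : Digraph V) : Prop :=
  ∃ R : V → V → Prop, ∀ (A : Type) [LinearOrder A], ∃ T : A → A → Prop, (∀ x, ¬ T x x) ∧
    ∀ S : V × A → V × A → Prop, (∀ p q, S p q → S q p) →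
      ∀ f : D.Adj ↪r (D.host R T S).Adj,
        ∃ u v w, S (f u) (f v) ∧ S (f v) (f w) ∧ S (f u) (f w)

/-- A relation on pairs of vertices of `D` that forces a pair of images to be special, together
with a triangle in this relation, yields a rigid host. -/
theorem HasRigidHost.of_triangle {D : Digraph V} (R : V → V → Prop) (P : V → V → Prop)
    (H : ∀ (A : Type) [LinearOrder A], ∃ T : A → A → Prop, (∀ x, ¬ T x x) ∧
      ∀ S : V × A → V × A → Prop, (∀ p q, S p q → S q p) →
        ∀ f : D.Adj ↪r (D.host R T S).Adj, ∀ u v, u ≠ v → P u v → S (f u) (f v))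
    {u v w : V} (huv : u ≠ v) (hvw : v ≠ w) (huw : u ≠ w) (h1 : P u v) (h2 : P v w)
    (h3 : P u w) : D.HasRigidHost := by
  refine ⟨R, fun A _ => ?_⟩
  obtain ⟨T, hT, h⟩ := H A
  exact ⟨T, hT, fun S hS f => ⟨u, v, w, h S hS f u v huv h1, h S hS f v w hvw h2,
    h S hS f u w huw h3⟩⟩

/-- With empty defaults, only special pairs carry edges. -/
theorem HasRigidHost.of_adjacent_triple {D : Digraph V} {u v w : V} (huv : u ≠ v) (hvw : v ≠ w)
    (huw : u ≠ w) (h1 : D.Adj u v ∨ D.Adj v u) (h2 : D.Adj v w ∨ D.Adj w v)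
    (h3 : D.Adj u w ∨ D.Adj w u) : D.HasRigidHost := by
  refine of_triangle (fun _ _ => False) (fun u v => D.Adj u v ∨ D.Adj v u)
    (fun A _ => ⟨fun _ _ => False, fun _ => id, ?_⟩) huv hvw huw h1 h2 h3
  intro S hS f u v _ h
  rw [← f.map_rel_iff (a := u), ← f.map_rel_iff (a := v)] at h
  have := hS (f v) (f u)
  simp only [host_adj] at h
  tauto

/-- With complete defaults, only special pairs can miss an edge. -/
theorem HasRigidHost.of_not_both_triple {D : Digraph V} {u v w : V} (huv : u ≠ v) (hvw : v ≠ w)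
    (huw : u ≠ w) (h1 : ¬ D.Adj u v ∨ ¬ D.Adj v u) (h2 : ¬ D.Adj v w ∨ ¬ D.Adj w v)
    (h3 : ¬ D.Adj u w ∨ ¬ D.Adj w u) : D.HasRigidHost := by
  refine of_triangle (fun _ _ => True) (fun u v => ¬ D.Adj u v ∨ ¬ D.Adj v u)
    (fun A _ => ⟨fun x y => x ≠ y, fun _ => by simp, ?_⟩) huv hvw huw h1 h2 h3
  intro S hS f u v huv h
  rw [← f.map_rel_iff (a := u), ← f.map_rel_iff (a := v)] at h
  have := hS (f v) (f u)
  have hne : ¬ ((f u).1 = (f v).1 ∧ (f u).2 = (f v).2) := fun h => huv (f.injective (Prod.ext h.1 h.2))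
  simp only [host_adj] at h
  grind

/-- With transitive tournaments as defaults, both between and inside parts, only special pairs can
be symmetric. -/
theorem HasRigidHost.of_symmetric_triple {D : Digraph V} {u v w : V} (huv : u ≠ v) (hvw : v ≠ w)
    (huw : u ≠ w) (h1 : D.Adj u v ↔ D.Adj v u) (h2 : D.Adj v w ↔ D.Adj w v)
    (h3 : D.Adj u w ↔ D.Adj w u) : D.HasRigidHost := by
  let _ : LinearOrder V := by classical exact linearOrderOfSTO WellOrderingRel
  refine of_triangle (fun x y => x < y) (fun u v => D.Adj u v ↔ D.Adj v u)
    (fun A _ => ⟨fun x y => x < y, fun _ => lt_irrefl _, ?_⟩) huv hvw huw h1 h2 h3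
  intro S hS f u v huv h
  rw [← f.map_rel_iff (a := u), ← f.map_rel_iff (a := v)] at h
  have h1 := hS (f v) (f u)
  have h1' := hS (f u) (f v)
  have hne : ¬ ((f u).1 = (f v).1 ∧ (f u).2 = (f v).2) := fun h => huv (f.injective (Prod.ext h.1 h.2))
  have h2 := lt_trichotomy (f u).1 (f v).1
  have h3 := lt_trichotomy (f u).2 (f v).2
  have h4 := lt_asymm (a := (f u).1) (b := (f v).1)
  have h5 := lt_asymm (a := (f u).2) (b := (f v).2)
  simp only [host_adj] at h
  grind

theorem host_fst_ne [LinearOrder A] {D : Digraph V} {R : V → V → Prop}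
    {S : V × A → V × A → Prop} {p q : V × A} (hpq : p ≠ q)
    (h : (D.host R (· < ·) S).Adj p q ↔ (D.host R (· < ·) S).Adj q p) : p.1 ≠ q.1 := by
  intro hp
  have hne : p.2 ≠ q.2 := fun h2 => hpq (Prod.ext hp h2)
  simp only [host_adj, hp, true_and, ne_eq, not_true_eq_false, false_and, or_false] at h
  rcases hne.lt_or_gt with h2 | h2
  · exact lt_asymm h2 (h.1 h2)
  · exact lt_asymm h2 (h.2 h2)

theorem host_adj_of_special {D : Digraph V} {R : V → V → Prop} {T : A → A → Prop}
    {S : V × A → V × A → Prop} {p q : V × A} (hpq : p.1 ≠ q.1) (h : S p q) :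
    (D.host R T S).Adj p q ↔ D.Adj p.1 q.1 := by
  simp [host_adj, hpq, h]

theorem host_adj_of_not_special {D : Digraph V} {R : V → V → Prop} {T : A → A → Prop}
    {S : V × A → V × A → Prop} {p q : V × A} (hpq : p.1 ≠ q.1) (h : ¬ S p q) :
    (D.host R T S).Adj p q ↔ R p.1 q.1 := by
  simp [host_adj, hpq, h]

/-- In a host with transitive tournaments inside the parts, a symmetric pair of `D` is mapped to
different parts, and its type is that of `D` or of `R` there. -/
theorem host_symmetric_pair [LinearOrder A] {D : Digraph V} {R : V → V → Prop}
    {S : V × A → V × A → Prop} (hS : ∀ p q, S p q → S q p)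
    (f : D.Adj ↪r (D.host R (· < ·) S).Adj) {u v : V} (huv : u ≠ v)
    (h : D.Adj u v ↔ D.Adj v u) : (f u).1 ≠ (f v).1 ∧
      (S (f u) (f v) ∧ (D.Adj u v ↔ D.Adj (f u).1 (f v).1) ∧
          (D.Adj u v ↔ D.Adj (f v).1 (f u).1) ∨
        ¬ S (f u) (f v) ∧ (D.Adj u v ↔ R (f u).1 (f v).1) ∧
          (D.Adj u v ↔ R (f v).1 (f u).1)) := by
  have hn : (f u).1 ≠ (f v).1 := host_fst_ne (f.injective.ne huv) (by
    rw [f.map_rel_iff, f.map_rel_iff, h])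
  refine ⟨hn, ?_⟩
  by_cases s : S (f u) (f v)
  · refine Or.inl ⟨s, ?_, ?_⟩
    · rw [← host_adj_of_special (R := R) (T := (· < ·)) hn s, f.map_rel_iff]
    · rw [← host_adj_of_special (R := R) (T := (· < ·)) hn.symm (hS _ _ s), f.map_rel_iff, h]
  · refine Or.inr ⟨s, ?_, ?_⟩
    · rw [← host_adj_of_not_special (D := D) (R := R) (T := (· < ·)) hn s, f.map_rel_iff]
    · rw [← host_adj_of_not_special (D := D) (R := R) (T := (· < ·)) hn.symm (mt (hS _ _) s), f.map_rel_iff, h]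

/-- The defaults are tournaments, so the two symmetric pairs are special. Their different types send
each to its own pair of parts, which puts `b` and `c` in their own parts. The default there is
reversed, so the third pair is special too. -/
theorem HasRigidHost.of_rainbow_three {D : Digraph V} {a b c : V} (hab : a ≠ b) (hac : a ≠ c)
    (hbc : b ≠ c) (hV : ∀ x, x = a ∨ x = b ∨ x = c) (h1 : D.Adj b c) (h2 : ¬ D.Adj c b)
    (h3 : D.Adj a b ↔ D.Adj b a) (h4 : D.Adj a c ↔ D.Adj c a) (h5 : ¬ (D.Adj a b ↔ D.Adj a c)) :
    D.HasRigidHost := by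
  -- Only the orientation `c → b`, opposite to `D`, matters; the orientation at `a` is arbitrary.
  refine ⟨fun x y => (x = a ∧ y ≠ a) ∨ (x = c ∧ y = b), fun A _ =>
    ⟨(· < ·), lt_irrefl, fun S hS f => ⟨a, b, c, ?_⟩⟩⟩
  have key : ∀ u v, u ≠ v → (D.Adj u v ↔ D.Adj v u) → S (f u) (f v) ∧
      (((f u).1 = a ∧ (f v).1 = b ∨ (f u).1 = b ∧ (f v).1 = a) ∧ (D.Adj u v ↔ D.Adj a b) ∨
       ((f u).1 = a ∧ (f v).1 = c ∨ (f u).1 = c ∧ (f v).1 = a) ∧ (D.Adj u v ↔ D.Adj a c)) := by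
    intro u v huv h
    have k := host_symmetric_pair hS f huv h
    rcases hV (f u).1 with pu | pu | pu <;> rcases hV (f v).1 with pv | pv | pv <;>
      simp only [pu, pv] at k <;> simp only [pu, pv] <;>
      simp [hab, hac, hbc, hab.symm, hac.symm, hbc.symm] at k ⊢ <;> tauto
  obtain ⟨s1, k1⟩ := key a b hab h3
  obtain ⟨s2, k2⟩ := key a c hac h4
  have pb : (f b).1 = b ∧ (f c).1 = c := by
    have k1 := k1.resolve_right fun h => h5 h.2
    have k2 := k2.resolve_left fun h => h5 h.2.symm
    obtain ⟨⟨pa, pb⟩ | ⟨pa, pb⟩, _⟩ := k1 <;> obtain ⟨⟨pa', pc⟩ | ⟨pa', pc⟩, _⟩ := k2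
    · exact ⟨pb, pc⟩
    · exact absurd (pa.symm.trans pa') hac
    · exact absurd (pa'.symm.trans pa) hab
    · exact absurd (pa.symm.trans pa') hbc
  refine ⟨s1, ?_, s2⟩
  by_contra s
  have hn : (f b).1 ≠ (f c).1 := by rwa [pb.1, pb.2]
  have e := (host_adj_of_not_special hn s).1 ((f.map_rel_iff (a := b) (b := c)).2 h1)
  simp only [pb.1, pb.2] at e
  rcases e with e | e
  · exact hab e.1.symm
  · exact hbc e.1

/-- In a host, an asymmetric pair of `D` that is mapped to different parts has the type of `D` or of
`R` there. -/
theorem host_asymmetric_pair {D : Digraph V} {R : V → V → Prop} {T : A → A → Prop}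
    {S : V × A → V × A → Prop} (hS : ∀ p q, S p q → S q p)
    (f : D.Adj ↪r (D.host R T S).Adj) {u v : V} (huv : D.Adj u v) (hvu : ¬ D.Adj v u)
    (hn : (f u).1 ≠ (f v).1) :
    S (f u) (f v) ∧ D.Adj (f u).1 (f v).1 ∨ R (f u).1 (f v).1 ∧ ¬ R (f v).1 (f u).1 := by
  by_cases s : S (f u) (f v)
  · exact Or.inl ⟨s, (host_adj_of_special hn s).1 (f.map_rel_iff.2 huv)⟩
  · exact Or.inr ⟨(host_adj_of_not_special hn s).1 (f.map_rel_iff.2 huv),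
      fun h => hvu (f.map_rel_iff.1 ((host_adj_of_not_special hn.symm (mt (hS _ _) s)).2 h))⟩

/-- The possible images of an alternating four-cycle. -/
theorem alternating_cycle_cases {a b c d i j k l : V} (hab : a ≠ b) (hac : a ≠ c)
    (had : a ≠ d) (hbc : b ≠ c) (hbd : b ≠ d) (hcd : c ≠ d)
    (h1 : s(i, k) = s(a, c) ∨ s(i, k) = s(b, d)) (h2 : s(j, l) = s(a, c) ∨ s(j, l) = s(b, d))
    (h3 : s(i, j) = s(a, b) ∨ s(i, j) = s(c, d) ∨ s(i, j) = s(b, c))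
    (h4 : s(k, l) = s(a, b) ∨ s(k, l) = s(c, d) ∨ s(k, l) = s(b, c)) :
    i = a ∧ j = b ∧ k = c ∧ l = d ∨ i = b ∧ j = a ∧ k = d ∧ l = c ∨
      i = c ∧ j = d ∧ k = a ∧ l = b ∨ i = d ∧ j = c ∧ k = b ∧ l = a := by
  simp only [Sym2.eq_iff] at h1 h2
  rcases h1 with (⟨rfl, rfl⟩ | ⟨rfl, rfl⟩) | (⟨rfl, rfl⟩ | ⟨rfl, rfl⟩) <;>
    rcases h2 with (⟨rfl, rfl⟩ | ⟨rfl, rfl⟩) | (⟨rfl, rfl⟩ | ⟨rfl, rfl⟩) <;>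
    simp [hab, hac, hbc, hab.symm, hac.symm, hbc.symm, had, had.symm, hbd, hbd.symm, hcd,
        hcd.symm] at h3 h4 ⊢

/-- Each type is a perfect matching of the four vertices. The symmetric pairs form a four-cycle,
whose image in the parts can only be moved by the Klein four-group; the asymmetric pairs rule out
two of these four placements, and in the other two `a`, `b`, `d` span a special triangle. -/
theorem HasRigidHost.of_rainbow_four {D : Digraph V} {a b c d : V} (hab : a ≠ b) (hac : a ≠ c)
    (had : a ≠ d) (hbc : b ≠ c) (hbd : b ≠ d) (hcd : c ≠ d)
    (hV : ∀ x, x = a ∨ x = b ∨ x = c ∨ x = d) (h1 : D.Adj a d) (h1' : ¬ D.Adj d a)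
    (h2 : ¬ D.Adj a b) (h2' : ¬ D.Adj b a) (h3 : ¬ D.Adj c d) (h3' : ¬ D.Adj d c)
    (h4 : D.Adj a c) (h4' : D.Adj c a) (h5 : D.Adj b d) (h5' : D.Adj d b)
    (h6 : ¬ (D.Adj b c ↔ D.Adj c b)) :
    D.HasRigidHost := by
  -- The pair `a d` is reversed and the pairs of the four-cycle become asymmetric. Parts `b`, `c`
  -- get the only symmetric default: both edges if `D` has `c → b`, none if it has `b → c`.
  let R : V → V → Prop := fun x y => (x = d ∧ y = a) ∨ (x = a ∧ y = b) ∨ (x = a ∧ y = c) ∨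
    (x = b ∧ y = d) ∨ (x = c ∧ y = d) ∨ (D.Adj c b ∧ (x = b ∧ y = c ∨ x = c ∧ y = b))
  have hD : ∀ i j, i ≠ j → (D.Adj i j ↔ D.Adj j i) →
      ¬ D.Adj i j ∧ (s(i, j) = s(a, b) ∨ s(i, j) = s(c, d)) ∨
      D.Adj i j ∧ (s(i, j) = s(a, c) ∨ s(i, j) = s(b, d)) := by
    intro i j hij h
    rcases hV i with rfl | rfl | rfl | rfl <;> rcases hV j with rfl | rfl | rfl | rfl <;>
      first
      | exact absurd rfl hij
      | exact absurd h h6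
      | exact absurd h.symm h6
      | simp [h1, h1'] at h
      | simp [*]
  have hR : ∀ i j, i ≠ j → (R i j ↔ R j i) → s(i, j) = s(b, c) ∧ (R i j ↔ D.Adj c b) := by
    intro i j hij h
    simp only [R] at h ⊢
    rcases hV i with rfl | rfl | rfl | rfl <;> rcases hV j with rfl | rfl | rfl | rfl <;>
      first
      | exact absurd rfl hij
      | simp [hab, hac, hbc, hab.symm, hac.symm, hbc.symm, had, had.symm, hbd, hbd.symm, hcd,
          hcd.symm] at h ⊢
  refine ⟨R, fun A _ => ⟨(· < ·), lt_irrefl, fun S hS f => ?_⟩⟩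
  have key : ∀ u v, u ≠ v → (D.Adj u v ↔ D.Adj v u) →
      (S (f u) (f v) ∧ (¬ D.Adj u v ∧
          (s((f u).1, (f v).1) = s(a, b) ∨ s((f u).1, (f v).1) = s(c, d)) ∨
        D.Adj u v ∧ (s((f u).1, (f v).1) = s(a, c) ∨ s((f u).1, (f v).1) = s(b, d)))) ∨
      ((D.Adj u v ↔ D.Adj c b) ∧ s((f u).1, (f v).1) = s(b, c)) := by
    intro u v huv h
    obtain ⟨hn, ⟨s, e1, e2⟩ | ⟨_, e1, e2⟩⟩ := host_symmetric_pair hS f huv h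
    · have := hD _ _ hn (e1.symm.trans e2)
      rw [← e1] at this
      exact Or.inl ⟨s, this⟩
    · have := hR _ _ hn (e1.symm.trans e2)
      exact Or.inr ⟨e1.trans this.2, this.1⟩
  have k1 := key a b hab (by simp [h2, h2'])
  have k2 := key a c hac (by simp [h4, h4'])
  have k3 := key b d hbd (by simp [h5, h5'])
  have k4 := key c d hcd (by simp [h3, h3'])
  have asym : ∀ u v, D.Adj u v → ¬ D.Adj v u → ∀ i j, (f u).1 = i → (f v).1 = j → i ≠ j →
      S (f u) (f v) ∧ D.Adj i j ∨ R i j ∧ ¬ R j i := by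
    rintro u v huv hvu i j rfl rfl hij
    exact host_asymmetric_pair hS f huv hvu hij
  have rda : R d a := Or.inl ⟨rfl, rfl⟩
  by_cases hcb : D.Adj c b
  · have hbc' : ¬ D.Adj b c := fun h => h6 (by simp [h, hcb])
    have rbc : R b c := by simp [R, hcb]
    have rcb : R c b := by simp [R, hcb]
    simp only [h2, h4, h5, h3, hcb, true_and, false_and, or_false, false_or, not_true_eq_false,
      not_false_eq_true, iff_true] at k1 k2 k3 k4
    rcases alternating_cycle_cases hac hab had hbc.symm hcd hbd k1.2 k4.2
      (k2.imp And.right (Eq.trans · Sym2.eq_swap) |> or_assoc.1)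
      (k3.imp And.right (Eq.trans · Sym2.eq_swap) |> or_assoc.1) with
      ⟨pa, pc, pb, pd⟩ | ⟨pa, pc, pb, pd⟩ | ⟨pa, pc, pb, pd⟩ | ⟨pa, pc, pb, pd⟩
    · refine ⟨a, b, d, k1.1, (k3.resolve_right ?_).1, ?_⟩
      · simp [pb, pd, hcd.symm, hbc, hbd.symm]
      · exact ((asym a d h1 h1' _ _ pa pd had).resolve_right fun h => h.2 rda).1
    · refine ⟨a, b, d, k1.1, (k3.resolve_right ?_).1, ?_⟩
      · simp [pb, pd, hbd.symm, hcd.symm]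
      · exact ((asym a d h1 h1' _ _ pa pd hbc.symm).resolve_right fun h => h.2 rbc).1
    · exact ((asym a d h1 h1' _ _ pa pd hbc).elim (fun h => hbc' h.2) fun h => h.2 rcb).elim
    · exact ((asym c b hcb hbc' _ _ pc pb hbc).elim (fun h => hbc' h.2) fun h => h.2 rcb).elim
  · have hbc' : D.Adj b c := by by_contra h; exact h6 (by simp [h, hcb])
    have rbc : ¬ R b c := by
      simp [R, hcb, hab.symm, hac.symm, hbc, hbd, hcd]
    have rcb : ¬ R c b := by
      simp [R, hcb, hab.symm, hac.symm, hbc.symm, hbd, hcd]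
    simp only [h2, h4, h5, h3, hcb, true_and, false_and, or_false, false_or, not_true_eq_false,
      not_false_eq_true, iff_false] at k1 k2 k3 k4
    rcases alternating_cycle_cases hab hac had hbc hbd hcd k2.2 k3.2
      (k1.imp And.right id |> or_assoc.1) (k4.imp And.right id |> or_assoc.1) with
      ⟨pa, pb, pc, pd⟩ | ⟨pa, pb, pc, pd⟩ | ⟨pa, pb, pc, pd⟩ | ⟨pa, pb, pc, pd⟩
    · refine ⟨a, b, d, (k1.resolve_right ?_).1, k3.1, ?_⟩
      · simp [pa, pb, hab, hac]
      · exact ((asym a d h1 h1' _ _ pa pd had).resolve_right fun h => h.2 rda).1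
    · refine ⟨a, b, d, (k1.resolve_right ?_).1, k3.1, ?_⟩
      · simp [pa, pb, hab, hac]
      · exact ((asym a d h1 h1' _ _ pa pd hbc).resolve_right fun h => rbc h.1).1
    · exact ((asym a d h1 h1' _ _ pa pd hbc.symm).elim (fun h => hcb h.2) fun h => rcb h.1).elim
    · exact ((asym b c hbc' hcb _ _ pb pc hbc.symm).elim (fun h => hcb h.2) fun h => rcb h.1).elim

/-- Every digraph on at least three vertices has a rigid host. -/
theorem hasRigidHost_of_three_le_card [Fintype V] (D : Digraph V)
    (hV : 3 ≤ Fintype.card V) : D.HasRigidHost := by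
  by_contra H
  -- Together, `t1`, `t2` and `t3` say that every triple has one pair of each type.
  have t1 : ∀ u v w, u ≠ v → v ≠ w → u ≠ w → ¬ ((D.Adj u v ∨ D.Adj v u) ∧
      (D.Adj v w ∨ D.Adj w v) ∧ (D.Adj u w ∨ D.Adj w u)) :=
    fun u v w huv hvw huw h => H (.of_adjacent_triple huv hvw huw h.1 h.2.1 h.2.2)
  have t2 : ∀ u v w, u ≠ v → v ≠ w → u ≠ w → ¬ ((¬ D.Adj u v ∨ ¬ D.Adj v u) ∧
      (¬ D.Adj v w ∨ ¬ D.Adj w v) ∧ (¬ D.Adj u w ∨ ¬ D.Adj w u)) :=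
    fun u v w huv hvw huw h => H (.of_not_both_triple huv hvw huw h.1 h.2.1 h.2.2)
  have t3 : ∀ u v w, u ≠ v → v ≠ w → u ≠ w → ¬ ((D.Adj u v ↔ D.Adj v u) ∧
      (D.Adj v w ↔ D.Adj w v) ∧ (D.Adj u w ↔ D.Adj w u)) :=
    fun u v w huv hvw huw h => H (.of_symmetric_triple huv hvw huw h.1 h.2.1 h.2.2)
  obtain ⟨a, d, had, h1, h1'⟩ : ∃ a d, a ≠ d ∧ D.Adj a d ∧ ¬ D.Adj d a := by
    obtain ⟨u, v, w, huv, huw, hvw⟩ := Fintype.two_lt_card_iff.1 hV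
    have := t3 u v w huv hvw huw
    by_contra! h
    exact this ⟨⟨h _ _ huv, h _ _ huv.symm⟩, ⟨h _ _ hvw, h _ _ hvw.symm⟩,
      ⟨h _ _ huw, h _ _ huw.symm⟩⟩
  have hx : ∀ x, x ≠ a → x ≠ d →
      (¬ D.Adj a x ∧ ¬ D.Adj x a ∧ D.Adj x d ∧ D.Adj d x) ∨
      (D.Adj a x ∧ D.Adj x a ∧ ¬ D.Adj x d ∧ ¬ D.Adj d x) := by
    intro x hxa hxd
    have e1 := t1 a x d hxa.symm hxd had
    have e2 := t2 a x d hxa.symm hxd had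
    tauto
  obtain ⟨x, hxa, hxd⟩ : ∃ x, x ≠ a ∧ x ≠ d := by
    classical
    by_contra! h
    have : (Finset.univ : Finset V) ⊆ {a, d} := fun y _ => by
      by_cases hy : y = a
      · simp [hy]
      · simp [h y hy]
    have := (Finset.card_le_card this).trans Finset.card_le_two
    rw [Finset.card_univ] at this
    omega
  by_cases h3 : ∀ y, y = a ∨ y = d ∨ y = x
  · refine H (.of_rainbow_three hxa hxd had (fun y => ?_) h1 h1' ?_ ?_ ?_)
    · have := h3 y; tauto
    all_goals have := hx x hxa hxd; tauto
  · push Not at h3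
    obtain ⟨y, hya, hyd, hyx⟩ := h3
    have hxy : ∀ x y, x ≠ a → x ≠ d → y ≠ a → y ≠ d → y ≠ x →
        ¬ (D.Adj a x ↔ D.Adj a y) ∧ ¬ (D.Adj x y ↔ D.Adj y x) := by
      intro x y hxa hxd hya hyd hyx
      have e1 := t1 a x y hxa.symm hyx.symm hya.symm
      have e2 := t2 a x y hxa.symm hyx.symm hya.symm
      have e3 := t3 a x y hxa.symm hyx.symm hya.symm
      have e6 := t1 d x y hxd.symm hyx.symm hyd.symm
      have e7 := t2 d x y hxd.symm hyx.symm hyd.symm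
      rcases hx x hxa hxd with ⟨p1, p2, p3, p4⟩ | ⟨p1, p2, p3, p4⟩ <;>
        rcases hx y hya hyd with ⟨q1, q2, q3, q4⟩ | ⟨q1, q2, q3, q4⟩ <;>
        by_cases r1 : D.Adj x y <;> by_cases r2 : D.Adj y x <;>
        simp [p1, p2, p3, p4, q1, q2, q3, q4, r1, r2] at e1 e2 e3 e6 e7 ⊢
    -- Apart from `a d`, pairs at `a` have only the two symmetric types, and by `hxy` no two share a
    -- type.
    have h4 : ∀ z, z = a ∨ z = d ∨ z = x ∨ z = y := by
      intro z
      by_contra! h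
      have e1 := hxy x y hxa hxd hya hyd hyx
      have e2 := hxy x z hxa hxd h.1 h.2.1 h.2.2.1
      have e3 := hxy y z hya hyd h.1 h.2.1 h.2.2.2
      tauto
    have e := hxy x y hxa hxd hya hyd hyx
    rcases hx x hxa hxd with ⟨p1, p2, p3, p4⟩ | ⟨p1, p2, p3, p4⟩ <;>
      rcases hx y hya hyd with ⟨q1, q2, q3, q4⟩ | ⟨q1, q2, q3, q4⟩
    · exact e.1 (iff_of_false p1 q1)
    · exact H (.of_rainbow_four hxa.symm hya.symm had hyx.symm hxd hyd
        (fun z => by rcases h4 z with h | h | h | h <;> simp [h])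
        h1 h1' p1 p2 q3 q4 q1 q2 p3 p4 e.2)
    · exact H (.of_rainbow_four hya.symm hxa.symm had hyx hyd hxd
        (fun z => by rcases h4 z with h | h | h | h <;> simp [h])
        h1 h1' q1 q2 p3 p4 p1 p2 q3 q4 fun h => e.2 h.symm)
    · exact e.1 (iff_of_true p1 q1)

end Host

end Digraph

/-! ### Counting embeddings -/

namespace Digraph

variable {V W : Type*}

theorem inducedCopies_le_card_embedding [Finite V] [Finite W] (D : Digraph V) (G : Digraph W) :
    D.inducedCopies G ≤ Nat.card (D.Adj ↪r G.Adj) := by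
  have : Finite (D.Adj ↪r G.Adj) := Finite.of_injective _ DFunLike.coe_injective
  have : {S : Set W | ∃ f : D.Adj ↪r G.Adj, Set.range f = S} =
      Set.range fun f : D.Adj ↪r G.Adj => Set.range f := rfl
  rw [inducedCopies, this, ← Nat.card_coe_set_eq]
  exact Finite.card_range_le _

/-- The induced removal lemma for digraphs on an arbitrary finite vertex type. -/
theorem InducedRemovalWith.exists_inducedFree [Fintype V] [Fintype W] {D : Digraph V} {δ : ℝ → ℝ}
    (h : D.InducedRemovalWith δ) {ε : ℝ} (hε : 0 < ε) (G : Digraph W) (hG : G.Loopless)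
    (hc : (Nat.card (D.Adj ↪r G.Adj) : ℝ) ≤ δ ε * (Fintype.card W : ℝ) ^ Fintype.card V) :
    ∃ G' : Digraph W, G'.Loopless ∧ D.InducedFree G' ∧
      (G.editDistance G' : ℝ) ≤ ε * (Fintype.card W : ℝ) ^ 2 := by
  let e := Fintype.equivFin W
  let H : Digraph (Fin (Fintype.card W)) := ⟨fun a b => G.Adj (e.symm a) (e.symm b)⟩
  let i : H.Adj ≃r G.Adj := ⟨e.symm, Iff.rfl⟩
  have hcard : Nat.card (D.Adj ↪r H.Adj) = Nat.card (D.Adj ↪r G.Adj) :=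
    Nat.card_congr
      ⟨fun f => f.trans i.toRelEmbedding, fun f => f.trans i.symm.toRelEmbedding,
        fun f => by ext; simp, fun f => by ext; simp⟩
  obtain ⟨H', h1, h2, h3⟩ := (h ε hε).2 _ H (fun v => hG _) (le_trans
    (by rw [← hcard]; exact_mod_cast inducedCopies_le_card_embedding D H) hc)
  refine ⟨⟨fun a b => H'.Adj (e a) (e b)⟩, fun v => h1 _,
    ⟨fun f => h2.elim' (f.trans ⟨e.toEmbedding, Iff.rfl⟩)⟩, le_trans ?_ h3⟩
  rw [Nat.cast_le, editDistance, editDistance]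
  refine Set.ncard_le_ncard_of_injOn (Prod.map e e) (fun p hp => ?_)
    (e.injective.prodMap e.injective).injOn (Set.toFinite _)
  simpa [H] using hp

/-- Embeddings all of which contain a triangle of special pairs are few, if two vertices of such a
triangle and the part of the third one determine the third one. -/
theorem card_embedding_le {A : Type*} [Fintype V] [Finite A] (D : Digraph V)
    (G : Digraph (V × A)) (S : V × A → V × A → Prop)
    (hS : ∀ p q r r' : V × A, S p q → S q r → S p r → S q r' → S p r' → r.1 = r'.1 → r = r')
    (hloop : ∀ p, ¬ S p p)
    (h : ∀ f : D.Adj ↪r G.Adj, ∃ u v w, S (f u) (f v) ∧ S (f v) (f w) ∧ S (f u) (f w)) :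
    Nat.card (D.Adj ↪r G.Adj) ≤
      Fintype.card V ^ 4 * Nat.card (V × A) ^ (Fintype.card V - 1) := by
  classical
  choose u v w h1 h2 h3 using h
  -- Record the triangle, the part of its third vertex, and the embedding away from that vertex.
  let F : (D.Adj ↪r G.Adj) → Σ t : V × V × V × V, ({x // x ≠ t.2.2.1} → V × A) :=
    fun f => ⟨(u f, v f, w f, (f (w f)).1), fun x => f x⟩
  have hF : Function.Injective F := by
    intro f g hfg
    have key : ∀ (u v w u' v' w' : V) (k k' : V), k = (f w).1 → k' = (g w').1 →
        S (f u) (f v) → S (f v) (f w) → S (f u) (f w) →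
        S (g u') (g v') → S (g v') (g w') → S (g u') (g w') →
        (⟨(u, v, w, k), fun x => f x⟩ : Σ t : V × V × V × V, ({x // x ≠ t.2.2.1} → V × A)) =
          ⟨(u', v', w', k'), fun x => g x⟩ → f = g := by
      intro u v w u' v' w' k k' hk hk' a1 a2 a3 b1 b2 b3 hh
      obtain ⟨h1, h2⟩ := Sigma.mk.inj_iff.1 hh
      simp only [Prod.mk.injEq] at h1
      obtain ⟨rfl, rfl, rfl, rfl⟩ := h1
      have h2 := eq_of_heq h2
      have hx : ∀ x, x ≠ w → f x = g x := fun x hx => congrFun h2 ⟨x, hx⟩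
      have hu : u ≠ w := by rintro rfl; exact hloop _ a3
      have hv : v ≠ w := by rintro rfl; exact hloop _ a2
      rw [← hx u hu, ← hx v hv] at *
      ext1 x
      by_cases hxw : x = w
      · subst hxw
        exact hS _ _ _ _ a1 a2 a3 b2 b3 (hk.symm.trans hk')
      · exact hx x hxw
    exact key _ _ _ _ _ _ _ _ rfl rfl (h1 f) (h2 f) (h3 f) (h1 g) (h2 g) (h3 g) hfg
  refine (Nat.card_le_card_of_injective F hF).trans (le_of_eq ?_)
  rw [Nat.card_sigma]
  have : ∀ t : V × V × V × V, Nat.card ({x // x ≠ t.2.2.1} → V × A) =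
      Nat.card (V × A) ^ (Fintype.card V - 1) := by
    intro t
    rw [Nat.card_fun, Nat.card_eq_fintype_card (α := {x // x ≠ t.2.2.1}), Fintype.card_subtype_compl,
      Fintype.card_subtype_eq]
  simp only [this, Finset.sum_const, Finset.card_univ, Fintype.card_prod, smul_eq_mul]
  ring

end Digraph

/-! ### Vectors on a sphere -/

/-- Many vectors with small coordinates lie on a common sphere. -/
theorem exists_large_sphere (r q : ℕ) (hr : 0 < r) (hq : 0 < q) :
    ∃ N : ℕ, q ^ r ≤ (r * q ^ 2) *
      (Finset.univ.filter fun d : Fin r → Fin q => ∑ t, (d t : ℕ) ^ 2 = N).card := by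
  by_contra! H
  have h1 : ∀ d ∈ (Finset.univ : Finset (Fin r → Fin q)),
      ∑ t, (d t : ℕ) ^ 2 ∈ Finset.range (r * q ^ 2) := by
    intro d _
    rw [Finset.mem_range]
    have : (Finset.univ : Finset (Fin r)).Nonempty := ⟨⟨0, hr⟩, Finset.mem_univ _⟩
    calc ∑ t, (d t : ℕ) ^ 2 < ∑ _t : Fin r, q ^ 2 :=
          Finset.sum_lt_sum_of_nonempty this fun t _ => Nat.pow_lt_pow_left (d t).2 two_ne_zero
      _ = r * q ^ 2 := by simp
  have h2 := Finset.card_eq_sum_card_fiberwise h1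
  have h3 : (Finset.range (r * q ^ 2)).Nonempty := ⟨0, Finset.mem_range.2 (by positivity)⟩
  have h4 : ∑ N ∈ Finset.range (r * q ^ 2), (r * q ^ 2) *
      (Finset.univ.filter fun d : Fin r → Fin q => ∑ t, (d t : ℕ) ^ 2 = N).card <
      ∑ _N ∈ Finset.range (r * q ^ 2), q ^ r := Finset.sum_lt_sum_of_nonempty h3 fun N _ => H N
  rw [← Finset.mul_sum, ← h2] at h4
  simp at h4

/-- A nontrivial affine relation between three points of a sphere forces the points to coincide. -/
theorem eq_of_affine_relation_on_sphere {ι : Type*} [Fintype ι] {x y z : ι → ℤ} {N a b c : ℤ}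
    (hx : ∑ t, x t ^ 2 = N) (hy : ∑ t, y t ^ 2 = N) (hz : ∑ t, z t ^ 2 = N) (ha : a ≠ 0)
    (hb : b ≠ 0) (hc : c ≠ 0) (habc : a + b = c) (h : ∀ t, a * x t + b * y t = c * z t) :
    x = z := by
  have e1 : ∑ t, (a * x t + b * y t) ^ 2 = ∑ t, (c * z t) ^ 2 := by simp only [h]
  have e2 : ∑ t, (c * z t) ^ 2 = c ^ 2 * N := by rw [← hz, Finset.mul_sum]; simp only [mul_pow]
  have e3 : ∑ t, (a * x t + b * y t) ^ 2 = a ^ 2 * N + b ^ 2 * N + 2 * a * b * ∑ t, x t * y t := by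
    nth_rewrite 1 [← hx]
    rw [← hy]
    simp only [Finset.mul_sum, ← Finset.sum_add_distrib]
    exact Finset.sum_congr rfl fun t _ => by ring
  have e4 : ∑ t, (x t - y t) ^ 2 = N + N - 2 * ∑ t, x t * y t := by
    nth_rewrite 1 [← hx]
    rw [← hy]
    simp only [Finset.mul_sum, ← Finset.sum_add_distrib, ← Finset.sum_sub_distrib]
    exact Finset.sum_congr rfl fun t _ => by ring
  -- Expanding `|a x + b y|² = (a + b)² N` leaves this as the only discrepancy.
  have e5 : a * b * ∑ t, (x t - y t) ^ 2 = 0 := by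
    rw [e4]; subst habc; linear_combination e3 - e2 - e1
  have e6 := (mul_eq_zero.1 e5).resolve_left (mul_ne_zero ha hb)
  rw [Finset.sum_eq_zero_iff_of_nonneg fun t _ => sq_nonneg _] at e6
  funext t
  have e7 : x t = y t := sub_eq_zero.1 (pow_eq_zero_iff two_ne_zero |>.1 (e6 t (Finset.mem_univ t)))
  have e8 := h t
  rw [← e7, ← add_mul, habc] at e8
  exact mul_left_cancel₀ hc e8

/-! ### The lower-bound construction -/

namespace Digraph

variable {V : Type*}

/-- Hosts with few induced copies of `D` that are far from being induced `D`-free: special pairs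
are those whose second coordinates differ by a multiple of a vector on a sphere. -/
theorem HasRigidHost.exists_far_host [Fintype V] {D : Digraph V} (hD : D.Loopless)
    (hrig : D.HasRigidHost) {r q : ℕ} (hr : 0 < r) (hq : 0 < q) :
    ∃ G : Digraph (V × (Fin r → Fin (Fintype.card V * q))), G.Loopless ∧
      Nat.card (D.Adj ↪r G.Adj) ≤ Fintype.card V ^ 4 *
        Nat.card (V × (Fin r → Fin (Fintype.card V * q))) ^ (Fintype.card V - 1) ∧
      ∀ G' : Digraph (V × (Fin r → Fin (Fintype.card V * q))), G'.Loopless → D.InducedFree G' →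
        q ^ (2 * r) ≤ r * q ^ 2 * G.editDistance G' := by
  obtain ⟨N, hN⟩ := exists_large_sphere r q hr hq
  set X := Finset.univ.filter fun d : Fin r → Fin q => ∑ t, (d t : ℕ) ^ 2 = N with hX
  let e := Fintype.equivFin V
  let l : V → ℤ := fun i => ((e i : ℕ) : ℤ)
  have hl : ∀ i j, i ≠ j → l j - l i ≠ 0 := by
    intro i j hij h
    refine hij (e.injective (Fin.ext ?_))
    simp only [l] at h
    omega
  let A := Fin r → Fin (Fintype.card V * q)
  let S : V × A → V × A → Prop := fun p p' => p.1 ≠ p'.1 ∧ ∃ d ∈ X, ∀ t,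
    ((p'.2 t : ℕ) : ℤ) - (p.2 t : ℕ) = (l p'.1 - l p.1) * (d t : ℕ)
  have hSsymm : ∀ p p', S p p' → S p' p := by
    rintro p p' ⟨h, d, hd, hp⟩
    exact ⟨h.symm, d, hd, fun t => by linear_combination -hp t⟩
  have hnorm : ∀ d ∈ X, ∑ t, ((d t : ℕ) : ℤ) ^ 2 = N := by
    intro d hd
    exact_mod_cast (Finset.mem_filter.1 hd).2
  have hSrigid : ∀ p q r r' : V × A, S p q → S q r → S p r → S q r' → S p r' → r.1 = r'.1 →
      r = r' := by
    rintro p q r r' ⟨n1, d1, hd1, e1⟩ ⟨n2, d2, hd2, e2⟩ ⟨n3, d3, hd3, e3⟩ ⟨n4, d4, hd4, e4⟩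
      ⟨n5, d5, hd5, e5⟩ hr
    -- The differences around a triangle add up, so `d3 = d1`; likewise `d5 = d1`, and `r`, `r'` are
    -- the same translate of `p`.
    have h3 := eq_of_affine_relation_on_sphere (hnorm d1 hd1) (hnorm d2 hd2) (hnorm d3 hd3)
      (hl _ _ n1) (hl _ _ n2) (hl _ _ n3) (by ring)
      (fun t => by linear_combination e3 t - e1 t - e2 t)
    have h5 := eq_of_affine_relation_on_sphere (hnorm d1 hd1) (hnorm d4 hd4) (hnorm d5 hd5)
      (hl _ _ n1) (hl _ _ n4) (hl _ _ n5) (by ring)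
      (fun t => by linear_combination e5 t - e1 t - e4 t)
    refine Prod.ext hr (funext fun t => Fin.ext ?_)
    have a3 := e3 t
    have a5 := e5 t
    rw [← congrFun h3 t] at a3
    rw [← congrFun h5 t, ← hr] at a5
    omega
  obtain ⟨R, hR⟩ := hrig
  obtain ⟨T, hT, hT'⟩ := @hR A (by classical exact linearOrderOfSTO WellOrderingRel)
  let G := D.host R T S
  have hG : G.Loopless := by
    intro p hp
    rw [host_adj] at hp
    exact hp.elim (fun h => hT _ h.2) fun h => h.1 rfl
  refine ⟨G, hG, card_embedding_le D G S hSrigid (fun p hp => hp.1 rfl)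
    (hT' S hSsymm), fun G' hG' hfree => ?_⟩
  have hbound : ∀ (x d : Fin q) (i : V), (x : ℕ) + (e i : ℕ) * d < Fintype.card V * q := by
    intro x d i
    calc (x : ℕ) + (e i : ℕ) * d < q + (e i : ℕ) * q :=
          add_lt_add_of_lt_of_le x.2 (Nat.mul_le_mul_left _ d.2.le)
      _ = (e i + 1) * q := by ring
      _ ≤ Fintype.card V * q := Nat.mul_le_mul_right _ (e i).2
  -- The planted copies `i ↦ x + (e i) d`; side length `Fintype.card V * q` leaves room for all of
  -- them.
  let φ : (Fin r → Fin q) × X → V → V × A :=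
    fun y i => (i, fun t => ⟨_, hbound (y.1 t) (y.2.1 t) i⟩)
  have hφ : ∀ y i j, G.Adj (φ y i) (φ y j) ↔ D.Adj i j := by
    intro y i j
    by_cases hij : i = j
    · subst hij
      exact iff_of_false (hG _) (hD _)
    · refine host_adj_of_special (p := φ y i) (q := φ y j) hij ⟨hij, y.2.1, y.2.2, fun t => ?_⟩
      simp only [φ, l]
      push_cast
      ring
  have hedit : ∀ y, ∃ i j, ¬ (G.Adj (φ y i) (φ y j) ↔ G'.Adj (φ y i) (φ y j)) := by
    intro y
    by_contra! h
    exact hfree.elim' ⟨⟨φ y, fun i j hij => congrArg Prod.fst hij⟩,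
      fun {i j} => ((h i j).symm.trans (hφ y i j))⟩
  choose i j hij using hedit
  have hne : ∀ y, i y ≠ j y := by
    intro y h
    have := hij y
    rw [h] at this
    exact this (iff_of_false (hG _) (hG' _))
  let F : (Fin r → Fin q) × X → {p : (V × A) × (V × A) | ¬ (G.Adj p.1 p.2 ↔ G'.Adj p.1 p.2)} :=
    fun y => ⟨(φ y (i y), φ y (j y)), hij y⟩
  -- Two points of a planted copy in different parts determine `d`, then `x`, so no edit serves two
  -- copies.
  have hF : Function.Injective F := by
    intro y z hyz
    have h := Subtype.ext_iff.1 hyz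
    simp only [F, φ, Prod.mk.injEq] at h
    obtain ⟨⟨hi, h1⟩, hj, h2⟩ := h
    have key : ∀ t, (y.1 t : ℕ) = z.1 t ∧ (y.2.1 t : ℕ) = z.2.1 t := by
      intro t
      have h1 : (y.1 t : ℕ) + (e (i y) : ℕ) * y.2.1 t = z.1 t + (e (i z) : ℕ) * z.2.1 t :=
        Fin.ext_iff.1 (congrFun h1 t)
      have h2 : (y.1 t : ℕ) + (e (j y) : ℕ) * y.2.1 t = z.1 t + (e (j z) : ℕ) * z.2.1 t :=
        Fin.ext_iff.1 (congrFun h2 t)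
      rw [← hi] at h1
      rw [← hj] at h2
      have h3 : (y.2.1 t : ℕ) = z.2.1 t := by
        zify at h1 h2 ⊢
        refine mul_left_cancel₀ (hl _ _ (hne y)) ?_
        simp only [l]
        linear_combination h2 - h1
      rw [h3] at h1
      exact ⟨Nat.add_right_cancel h1, h3⟩
    exact Prod.ext (funext fun t => Fin.ext (key t).1)
      (Subtype.ext (funext fun t => Fin.ext (key t).2))
  have hcard := Nat.card_le_card_of_injective F hF
  rw [Nat.card_prod, Nat.card_coe_set_eq, Nat.card_eq_fintype_card,
    Nat.card_eq_fintype_card, Fintype.card_coe, Fintype.card_fun, Fintype.card_fin,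
    Fintype.card_fin] at hcard
  calc q ^ (2 * r) = q ^ r * q ^ r := by ring
    _ ≤ q ^ r * (r * q ^ 2 * X.card) := Nat.mul_le_mul_left _ hN
    _ = r * q ^ 2 * (q ^ r * X.card) := by ring
    _ ≤ r * q ^ 2 * G.editDistance G' := Nat.mul_le_mul_left _ hcard

/-- A polynomial in `C * q ^ 2` is eventually dominated by a large power of `q`. -/
theorem exists_nat_eval_le_pow (P : Polynomial ℝ) (C K : ℝ) :
    ∃ q : ℕ, 0 < q ∧ K * P.eval (C * (q : ℝ) ^ 2) ≤ (q : ℝ) ^ (2 * P.natDegree + 1) := by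
  let Q : Polynomial ℝ := Polynomial.C K * P.comp (Polynomial.C C * Polynomial.X ^ 2)
  have hQ : Q.degree < (Polynomial.X ^ (2 * P.natDegree + 1) : Polynomial ℝ).degree := by
    rw [Polynomial.degree_X_pow]
    refine Polynomial.degree_le_natDegree.trans_lt (Nat.cast_lt.2 ?_)
    have h1 : (Polynomial.C C * Polynomial.X ^ 2 : Polynomial ℝ).natDegree ≤ 2 :=
      Polynomial.natDegree_C_mul_X_pow_le _ _
    have h2 := (Polynomial.natDegree_C_mul_le K (P.comp (Polynomial.C C * Polynomial.X ^ 2))).trans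
      (Polynomial.natDegree_comp_le.trans (Nat.mul_le_mul_left _ h1))
    simp only [Q]
    omega
  have h := (Polynomial.div_tendsto_atTop_zero_of_degree_lt _ _ hQ).comp tendsto_natCast_atTop_atTop
  have h1 := (h.eventually (gt_mem_nhds (zero_lt_one))).and (Filter.eventually_gt_atTop 0)
  obtain ⟨q, h2, hq⟩ := h1.exists
  refine ⟨q, hq, ?_⟩
  simp only [Function.comp, Q, Polynomial.eval_mul, Polynomial.eval_C, Polynomial.eval_comp,
    Polynomial.eval_pow, Polynomial.eval_X] at h2
  rw [div_lt_one (by positivity)] at h2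
  exact h2.le

/-- The dimension `r` exceeds `2 * P.natDegree` and stays fixed while `q` grows. The host needs
edits at a density of order `q ^ (-2)`, but its density of copies is of order `q ^ (-r)`, too small
for `P`. -/
theorem HasRigidHost.not_inducedEasilyTestable [Fintype V] {D : Digraph V} (hD : D.Loopless)
    (hrig : D.HasRigidHost) (hV : 0 < Fintype.card V) : ¬ D.InducedEasilyTestable := by
  rintro ⟨δ, hδ, P, hP⟩
  set h := Fintype.card V with hh
  set r := 2 * P.natDegree + 1 with hr
  obtain ⟨q, hq, hPq⟩ := exists_nat_eval_le_pow P (2 * r * (h : ℝ) ^ (2 * r + 2)) ((h : ℝ) ^ 4)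
  obtain ⟨G, hG, hfew, hfar⟩ := hrig.exists_far_host hD (r := r) (q := q) (by omega) hq
  -- With `n = h * (h * q) ^ r` and `ε = 1 / (C * q ^ 2)`, the budget `ε * n ^ 2` is half of the
  -- required `q ^ (2 * r) / (r * q ^ 2)`.
  set C : ℝ := 2 * r * (h : ℝ) ^ (2 * r + 2) with hC
  have hr1 : (1 : ℝ) ≤ r := by exact_mod_cast (by omega : 1 ≤ r)
  have hh1 : (1 : ℝ) ≤ h := by exact_mod_cast hV
  have hq1 : (1 : ℝ) ≤ q := by exact_mod_cast hq
  have hC1 : 1 < C * (q : ℝ) ^ 2 := by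
    have h1 : (1 : ℝ) ≤ (h : ℝ) ^ (2 * r + 2) := one_le_pow₀ hh1
    have h2 : (1 : ℝ) ≤ (q : ℝ) ^ 2 := one_le_pow₀ hq1
    have h3 : (1 : ℝ) ≤ r * (h : ℝ) ^ (2 * r + 2) := one_le_mul_of_one_le_of_one_le hr1 h1
    have h4 := one_le_mul_of_one_le_of_one_le h3 h2
    rw [hC]
    linarith
  have hε : 0 < 1 / (C * (q : ℝ) ^ 2) := by positivity
  have hδ0 := (hδ _ hε).1
  have hδP := hP _ hε ((div_lt_one (by positivity)).2 hC1)
  rw [one_div_one_div] at hδP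
  have hn : Fintype.card (V × (Fin r → Fin (Fintype.card V * q))) = h * (h * q) ^ r := by
    simp [hh]
  have hδn : (h : ℝ) ^ 4 ≤ δ (1 / (C * (q : ℝ) ^ 2)) * (h * (h * q) ^ r) := by
    have h1 : (h : ℝ) ^ 4 ≤ δ (1 / (C * (q : ℝ) ^ 2)) * (q : ℝ) ^ r := by
      rw [← div_le_iff₀' hδ0, div_eq_mul_one_div]
      exact (mul_le_mul_of_nonneg_left hδP (by positivity)).trans hPq
    refine h1.trans (mul_le_mul_of_nonneg_left ?_ hδ0.le)
    rw [mul_pow, ← mul_assoc]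
    exact le_mul_of_one_le_left (by positivity)
      (one_le_mul_of_one_le_of_one_le hh1 (one_le_pow₀ hh1))
  obtain ⟨G', hG', hfree, hdist⟩ := hδ.exists_inducedFree hε G hG (by
    refine (Nat.cast_le.2 hfew).trans ?_
    rw [Nat.card_eq_fintype_card, hn, ← hh]
    push_cast
    rw [show ∀ x : ℝ, x ^ h = x * x ^ (h - 1) from fun x => (mul_pow_sub_one hV.ne' x).symm,
      ← mul_assoc]
    exact mul_le_mul_of_nonneg_right hδn (by positivity))
  have hfar' : (q : ℝ) ^ (2 * r) ≤ r * (q : ℝ) ^ 2 * (G.editDistance G' : ℝ) := by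
    exact_mod_cast hfar G' hG' hfree
  rw [hn] at hdist
  have h1 : (r : ℝ) * (q : ℝ) ^ 2 * (1 / (C * (q : ℝ) ^ 2) * ((h * (h * q) ^ r : ℕ) : ℝ) ^ 2) =
      (q : ℝ) ^ (2 * r) / 2 := by
    push_cast
    rw [hC]
    field_simp
    ring
  have h2 := hfar'.trans (mul_le_mul_of_nonneg_left hdist (by positivity))
  rw [h1] at h2
  have h3 : (0 : ℝ) < (q : ℝ) ^ (2 * r) := by positivity
  linarith

end Digraph

/-! ### Two vertices -/

namespace Digraph

variable {V : Type*}

/-- If `D` has two vertices, recolouring the pairs that induce a copy of `D` makes a digraph induced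
`D`-free, at the cost of at most two entries for each copy. -/
theorem exists_inducedFree_of_card_eq_two [Fintype V] {D : Digraph V} (hD : D.Loopless)
    (hV : Fintype.card V = 2) {n : ℕ} (G : Digraph (Fin n))
    (hG : G.Loopless) : ∃ G' : Digraph (Fin n), G'.Loopless ∧ D.InducedFree G' ∧
      G.editDistance G' ≤ 2 * D.inducedCopies G := by
  classical
  obtain ⟨a, b, hab, hV⟩ : ∃ a b : V, a ≠ b ∧ ∀ x, x = a ∨ x = b := by
    obtain ⟨a, b, hab, h⟩ := Finset.card_eq_two.1 hV
    refine ⟨a, b, hab, fun x => ?_⟩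
    have hx := Finset.mem_univ x
    rw [h] at hx
    simpa using hx
  let 𝒞 : Set (Set (Fin n)) := {S | ∃ f : D.Adj ↪r G.Adj, Set.range f = S}
  -- A pair spanning a copy gets both edges if `D` is edgeless and none otherwise, so never the type
  -- of `D`.
  let G' : Digraph (Fin n) := ⟨fun u v => u ≠ v ∧
    if {u, v} ∈ 𝒞 then ∀ x y, ¬ D.Adj x y else G.Adj u v⟩
  have hG' : ∀ u v, G'.Adj u v ↔ u ≠ v ∧
    if {u, v} ∈ 𝒞 then ∀ x y, ¬ D.Adj x y else G.Adj u v := fun u v => Iff.rfl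
  refine ⟨G', fun v hv => hv.1 rfl, ⟨fun f => ?_⟩, ?_⟩
  · have hne : f a ≠ f b := f.injective.ne hab
    have hrange : Set.range f = {f a, f b} := by
      ext x
      constructor
      · rintro ⟨y, rfl⟩
        rcases hV y with rfl | rfl <;> simp
      · rintro (rfl | rfl) <;> exact Set.mem_range_self _
    by_cases hc : {f a, f b} ∈ 𝒞
    · have h1 : D.Adj a b ↔ ∀ x y, ¬ D.Adj x y := by
        rw [← f.map_rel_iff, hG', if_pos hc]
        exact and_iff_right hne
      have h2 : D.Adj b a ↔ ∀ x y, ¬ D.Adj x y := by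
        rw [← f.map_rel_iff, hG', Set.pair_comm, if_pos hc]
        exact and_iff_right hne.symm
      have h3 : ¬ ∀ x y, ¬ D.Adj x y := fun h => h a b (h1.2 h)
      refine h3 fun x y => ?_
      rcases hV x with rfl | rfl <;> rcases hV y with rfl | rfl
      exacts [hD _, mt h1.1 h3, mt h2.1 h3, hD _]
    · have h1 : G.Adj (f a) (f b) ↔ D.Adj a b := by
        rw [← f.map_rel_iff, hG', if_neg hc]
        exact (and_iff_right hne).symm
      have h2 : G.Adj (f b) (f a) ↔ D.Adj b a := by
        rw [← f.map_rel_iff, hG', Set.pair_comm, if_neg hc]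
        exact (and_iff_right hne.symm).symm
      refine hc ⟨⟨⟨f, f.injective⟩, fun {x y} => ?_⟩, hrange⟩
      rcases hV x with rfl | rfl <;> rcases hV y with rfl | rfl
      exacts [iff_of_false (hG _) (hD _), h1, h2, iff_of_false (hG _) (hD _)]
  · have hmem : ∀ p ∈ {p : Fin n × Fin n | ¬ (G.Adj p.1 p.2 ↔ G'.Adj p.1 p.2)},
        p.1 ≠ p.2 ∧ {p.1, p.2} ∈ 𝒞 := by
      intro p hp
      have hne : p.1 ≠ p.2 := by
        intro h
        rw [Set.mem_ofPred_eq, h, hG'] at hp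
        exact hp (iff_of_false (hG _) fun h => h.1 rfl)
      refine ⟨hne, by_contra fun hc => hp ?_⟩
      rw [hG', if_neg hc]
      exact (and_iff_right hne).symm
    have hcard : (𝒞 ×ˢ (Set.univ : Set Bool)).ncard = 2 * D.inducedCopies G := by
      rw [Set.ncard_prod, Set.ncard_univ, Nat.card_eq_fintype_card, Fintype.card_bool, mul_comm]
      rfl
    rw [← hcard, editDistance]
    -- The Boolean tells apart the two entries on the same vertex pair.
    refine Set.ncard_le_ncard_of_injOn (fun p => (({p.1, p.2} : Set (Fin n)), decide (p.1 < p.2)))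
      (fun p hp => ⟨(hmem p hp).2, trivial⟩) (fun p hp p' hp' h => ?_) (Set.toFinite _)
    simp only [Prod.mk.injEq, decide_eq_decide] at h
    rcases Set.pair_eq_pair_iff.1 h.1 with h1 | h1
    · exact Prod.ext h1.1 h1.2
    · have := (hmem p hp).1
      rw [← h1.1, ← h1.2] at h
      have := h.2
      omega

theorem inducedEasilyTestable_of_card_eq_two [Fintype V] {D : Digraph V} (hD : D.Loopless)
    (hV : Fintype.card V = 2) : D.InducedEasilyTestable := by
  refine ⟨fun ε => ε / 2, fun ε hε => ⟨by positivity, fun n G hG hc => ?_⟩,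
    2 * Polynomial.X, fun ε _ _ => ?_⟩
  · obtain ⟨G', h1, h2, h3⟩ := exists_inducedFree_of_card_eq_two hD hV G hG
    refine ⟨G', h1, h2, ?_⟩
    have h3 : (G.editDistance G' : ℝ) ≤ 2 * (D.inducedCopies G : ℝ) := by exact_mod_cast h3
    rw [hV] at hc
    linarith
  · simp [div_eq_mul_inv]

end Digraph

theorem mainTheorem1 {V : Type*} [Fintype V] (D : Digraph V) (hD : D.Loopless)
    (hV : 2 ≤ Fintype.card V) :
    D.InducedEasilyTestable ↔ Fintype.card V = 2 := by
  refine ⟨fun h => ?_, D.inducedEasilyTestable_of_card_eq_two hD⟩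
  by_contra h2
  exact (D.hasRigidHost_of_three_le_card (by omega)).not_inducedEasilyTestable hD (by omega) h
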